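/- Let $\mathcal H$ be a real Hilbert space, let $\mathcal D$ be a subset of a real normed space $\mathcal G$ (with the induced topology and metric), and let $f_i:\mathcal D\to\mathbb R$ and $g_i:\mathcal D\to\mathcal H$, $i\in I_1=\{1,\dots,q\}$, be locally Lipschitz on $\mathcal D$. For $p\in\mathcal D$ put $$C(p)=\{x\in\mathcal H \mid \langle x\mid g_i(p)\rangle=f_i(p),\ i\in I_1\},$$ and let $P(v,p)$ denote the projection of $v\in\mathcal H$ onto $C(p)$, i.e. the solution of $\min_{x\in C(p)}\frac12\|x-v\|^2$ (which exists and is unique whenever $C(p)\neq\emptyset$). Let $\bar p\in\mathcal D$, $\bar v\notin C(\bar p)$, $\bar x=P(\bar v,\bar p)$, and suppose that 1. there is a neighbourhood $U(\bar p)$ of $\bar p$ in $\mathcal D$ such that $\operatorname{rank}\{g_i(p),\ i\in I_1\}=\operatorname{rank}\{g_i(\bar p),\ i\in I_1\}$ for all $p\in U(\bar p)$; 2. $\bar x\in\liminf_{p\to\bar p,\ p\in\mathcal D}C(p)$ (lower Kuratowski limit), i.e. for every neighbourhood $V$ of $\bar x$ there is a neighbourhood $U$ of $\bar p$ in $\mathcal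 D$ with $V\cap C(p)\neq\emptyset$ for all $p\in U$. Then $P$ is locally Lipschitz at $(\bar v,\bar p)$: there are neighbourhoods $W$ of $\bar v$ in $\mathcal H$ and $U$ of $\bar p$ in $\mathcal D$ such that $P(v,p)$ is well defined for all $(v,p)\in W\times U$ (the minimization problem has exactly one solution), and $P$ is Lipschitz on $W\times U$. -/

import Mathlib

open Filter Topology
open scoped NNReal

noncomputable section

namespace MovingProjection

variable {H : Type*} [NormedAddCommGroup H] [InnerProductSpace ℝ H]

/-- The moving set `C(p) = {x | ⟨x, g i p⟩ = f i p for all i}` cut out by the equality constraints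
with normals `g i p` and right-hand sides `f i p`. -/
def constraintSet {D ι : Type*} (f : ι → D → ℝ) (g : ι → D → H) (p : D) : Set H :=
  {x | ∀ i, inner ℝ x (g i p) = f i p}

/-- `x` solves the problem: minimize `‖x - v‖² / 2` subject to `x ∈ K`. -/
def IsProjection (K : Set H) (v x : H) : Prop :=
  x ∈ K ∧ IsMinOn (fun z => (1 / 2 : ℝ) * ‖z - v‖ ^ 2) K x

/-- The projection of `v` onto `K`: a solution of the problem above, and an arbitrary
point if there is no solution. (A nonempty closed convex set of a Hilbert space has exactly one.) -/
def projection (K : Set H) (v : H) : H :=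
  Classical.epsilon (IsProjection K v)

/-- The lower Kuratowski limit of the multifunction `F` at `pbar`: the points `y` every neighbourhood
of which meets `F p` for all `p` in some neighbourhood of `pbar`. -/
def lowerKuratowskiLimit {D X : Type*} [TopologicalSpace D] [TopologicalSpace X]
    (F : D → Set X) (pbar : D) : Set X :=
  {y | ∀ V ∈ 𝓝 y, ∃ U ∈ 𝓝 pbar, ∀ p ∈ U, (V ∩ F p).Nonempty}

/-- The rank of a family of vectors, that is, the dimension of its linear span. -/
def familyRank {ι : Type*} (u : ι → H) : ℕ :=
  Module.finrank ℝ (Submodule.span ℝ (Set.range u))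

end MovingProjection

end

open Filter Topology
open scoped NNReal

namespace MovingProjection

section Gram

variable {H : Type*} [NormedAddCommGroup H] [InnerProductSpace ℝ H]
variable {κ : Type*} [Fintype κ]

/-! Choose a subfamily of the `g i pbar` that is a basis of their span. Linear independence is an
open condition, so the same indices stay independent for `p` near `pbar`, and constant rank forces
them to keep spanning all the `g i p`. Once `C(p)` is nonempty, the remaining equations follow from
the selected ones, so the projection solves a system with invertible Gram matrix. The resulting
formula `affineProjection` is C¹ in the point, the right-hand sides and the normals, hence locally
Lipschitz; composing it with the locally Lipschitz data gives the claim
(`isProjection_constraintSet_iff`, `contDiffAt_affineProjection`). -/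

open Classical in
/-- The endomorphism of `κ → ℝ` whose matrix is the Gram matrix of the family `u`. -/
noncomputable def gramOperator (u : κ → H) : (κ → ℝ) →L[ℝ] (κ → ℝ) :=
  ∑ j, ∑ k, (inner ℝ (u k) (u j) : ℝ) •
    (ContinuousLinearMap.proj (R := ℝ) (φ := fun _ : κ => ℝ) k).smulRight (Pi.single j (1 : ℝ))

lemma gramOperator_apply (u : κ → H) (c : κ → ℝ) (j : κ) :
    gramOperator u c j = inner ℝ (∑ k, c k • u k) (u j) := by
  classical
  simp [gramOperator, sum_inner, inner_smul_left, Finset.sum_apply, Pi.single_apply,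
    mul_comm]

lemma contDiff_gramOperator : ContDiff ℝ 1 (gramOperator : (κ → H) → _) := by
  unfold gramOperator
  refine ContDiff.sum fun j _ => ContDiff.sum fun k _ =>
    ContDiff.fun_smul ?_ contDiff_const
  exact (contDiff_apply ℝ H k).inner ℝ (contDiff_apply ℝ H j)

/-- A combination of the `u k` whose coefficients lie in the kernel is orthogonal to every `u j`,
hence to itself, so it vanishes. -/
lemma isUnit_gramOperator {u : κ → H} (hu : LinearIndependent ℝ u) :
    IsUnit (gramOperator u) := by
  have hinj : Function.Injective (gramOperator u : (κ → ℝ) →ₗ[ℝ] (κ → ℝ)) := by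
    rw [injective_iff_map_eq_zero]
    intro c hc
    have h0 : ∀ j, inner ℝ (∑ k, c k • u k) (u j) = (0 : ℝ) := fun j => by
      rw [← gramOperator_apply]
      exact congrFun hc j
    have h1 : ∑ k, c k • u k = 0 := by
      rw [← inner_self_eq_zero (𝕜 := ℝ)]
      conv_lhs => rw [inner_sum]
      simp only [inner_smul_right, h0, mul_zero, Finset.sum_const_zero]
    exact funext (Fintype.linearIndependent_iff.mp hu c h1)
  let e := (LinearEquiv.ofInjectiveEndo _ hinj).toContinuousLinearEquiv
  exact ⟨ContinuousLinearEquiv.toUnit e, by ext; rfl⟩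

/-- The candidate for the projection of `v` onto `{x | ∀ j, ⟪x, u j⟫ = a j}`, obtained by solving
the normal equations. -/
noncomputable def affineProjection (z : H × (κ → ℝ) × (κ → H)) : H :=
  z.1 - ∑ j, Ring.inverse (gramOperator z.2.2) (fun k => inner ℝ z.1 (z.2.2 k) - z.2.1 k) j •
    z.2.2 j

lemma contDiffAt_affineProjection {z : H × (κ → ℝ) × (κ → H)}
    (hz : IsUnit (gramOperator z.2.2)) : ContDiffAt ℝ 1 affineProjection z := by
  have hu (j : κ) : ContDiffAt ℝ 1 (fun z : H × (κ → ℝ) × (κ → H) => z.2.2 j) z := by fun_prop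
  have ha (j : κ) : ContDiffAt ℝ 1 (fun z : H × (κ → ℝ) × (κ → H) => z.2.1 j) z := by fun_prop
  have hG : ContDiffAt ℝ 1
      (fun z : H × (κ → ℝ) × (κ → H) => Ring.inverse (gramOperator z.2.2)) z := by
    obtain ⟨w, hw⟩ := hz
    have h1 : ContDiffAt ℝ 1 Ring.inverse (gramOperator z.2.2) := by
      rw [← hw]
      exact contDiffAt_ringInverse ℝ w
    have h2 : ContDiff ℝ 1 (fun z : H × (κ → ℝ) × (κ → H) => gramOperator z.2.2) :=
      contDiff_gramOperator.comp (contDiff_snd.comp contDiff_snd)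
    exact ContDiffAt.comp (f := fun z : H × (κ → ℝ) × (κ → H) => gramOperator z.2.2)
      z h1 h2.contDiffAt
  have hc : ContDiffAt ℝ 1 (fun z : H × (κ → ℝ) × (κ → H) =>
      (fun k => inner ℝ z.1 (z.2.2 k) - z.2.1 k : κ → ℝ)) z :=
    contDiffAt_pi.mpr fun k => (contDiffAt_fst.inner ℝ (hu k)).sub (ha k)
  refine contDiffAt_fst.sub (ContDiffAt.sum fun j _ => ContDiffAt.fun_smul ?_ (hu j))
  exact contDiffAt_pi.mp (hG.clm_apply hc) j

lemma inner_affineProjection {u : κ → H} (hu : IsUnit (gramOperator u)) (v : H) (a : κ → ℝ)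
    (j : κ) : inner ℝ (affineProjection (v, a, u)) (u j) = a j := by
  have h := congrFun (DFunLike.congr_fun (Ring.mul_inverse_cancel _ hu)
    (fun k => inner ℝ v (u k) - a k)) j
  rw [mul_apply_eq_comp, gramOperator_apply] at h
  simp only [affineProjection, inner_sub_left, h, one_apply_eq_self]
  ring

lemma sub_affineProjection_mem_span (u : κ → H) (v : H) (a : κ → ℝ) :
    v - affineProjection (v, a, u) ∈ Submodule.span ℝ (Set.range u) := by
  simp only [affineProjection, sub_sub_cancel]
  exact Submodule.sum_mem _ fun j _ =>
    Submodule.smul_mem _ _ (Submodule.subset_span (Set.mem_range_self j))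

end Gram

lemma projection_eq_of_forall_isProjection_iff {H : Type*} [NormedAddCommGroup H]
    {K : Set H} {v y : H}
    (h : ∀ x, IsProjection K v x ↔ x = y) : projection K v = y :=
  (h _).mp (Classical.epsilon_spec ⟨y, (h y).mpr rfl⟩)

section Projection

variable {H : Type*} [NormedAddCommGroup H] [InnerProductSpace ℝ H]

/-- Pythagoras: `‖x - v‖²` exceeds `‖y - v‖²` by exactly `‖x - y‖²`. -/
lemma isProjection_iff_eq_of_inner_eq_zero {K : Set H} {v y : H} (hy : y ∈ K)
    (horth : ∀ x ∈ K, inner ℝ (x - y) (v - y) = 0) (x : H) :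
    IsProjection K v x ↔ x = y := by
  have key : ∀ x ∈ K, ‖x - v‖ ^ 2 = ‖x - y‖ ^ 2 + ‖y - v‖ ^ 2 := fun x hx => by
    have h := norm_sub_sq_real (x - y) (v - y)
    rw [sub_sub_sub_cancel_right, horth x hx, norm_sub_rev v y] at h
    linarith
  constructor
  · rintro ⟨hxK, hmin⟩
    have h1 : (1 / 2 : ℝ) * ‖x - v‖ ^ 2 ≤ 1 / 2 * ‖y - v‖ ^ 2 := hmin hy
    have h2 : ‖x - y‖ ^ 2 = 0 := le_antisymm (by linarith [key x hxK]) (sq_nonneg _)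
    rwa [sq_eq_zero_iff, norm_sub_eq_zero_iff] at h2
  · rintro rfl
    refine ⟨hy, fun z hz => ?_⟩
    change (1 / 2 : ℝ) * ‖x - v‖ ^ 2 ≤ 1 / 2 * ‖z - v‖ ^ 2
    linarith [key z hz, sq_nonneg ‖z - x‖]

lemma inner_eq_zero_of_mem_span_range {ι : Type*} {u : ι → H} {x w : H}
    (h : ∀ i, inner ℝ x (u i) = (0 : ℝ)) (hw : w ∈ Submodule.span ℝ (Set.range u)) :
    inner ℝ x w = (0 : ℝ) := by
  induction hw using Submodule.span_induction with
  | mem _ hm => obtain ⟨i, rfl⟩ := hm; exact h i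
  | zero => exact inner_zero_right x
  | add _ _ _ _ h1 h2 => rw [inner_add_right, h1, h2, add_zero]
  | smul r _ _ h1 => rw [inner_smul_right, h1, mul_zero]

/-- The candidate `y` is built from the selected equations only. Any `z ∈ C(p)` satisfies them too,
so `z - y` is orthogonal to the whole span of the normals. One such `z` transfers the other
equations to `y`; since `v - y` lies in that span, `y` is the projection. -/
lemma isProjection_constraintSet_iff {D ι κ : Type*} [Fintype κ] {f : ι → D → ℝ}
    {g : ι → D → H} {p : D} (hC : (constraintSet f g p).Nonempty) {s : κ → ι}
    (hs : IsUnit (gramOperator fun j => g (s j) p))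
    (hspan : Submodule.span ℝ (Set.range fun j => g (s j) p) =
      Submodule.span ℝ (Set.range fun i => g i p)) (v x : H) :
    IsProjection (constraintSet f g p) v x ↔
      x = affineProjection (v, (fun j => f (s j) p), fun j => g (s j) p) := by
  set y := affineProjection (v, (fun j => f (s j) p), fun j => g (s j) p) with hydef
  have hyJ : ∀ j, inner ℝ y (g (s j) p) = f (s j) p :=
    inner_affineProjection hs v fun j => f (s j) p
  have horth : ∀ z ∈ constraintSet f g p, ∀ w ∈ Submodule.span ℝ (Set.range fun i => g i p),
      inner ℝ (z - y) w = (0 : ℝ) := fun z hz w hw => by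
    refine inner_eq_zero_of_mem_span_range (fun j => ?_) (hspan ▸ hw)
    rw [inner_sub_left, hyJ, hz (s j), sub_self]
  refine isProjection_iff_eq_of_inner_eq_zero ?_ (fun z hz => horth z hz _ ?_) x
  · obtain ⟨z, hz⟩ := hC
    intro i
    have h := horth z hz _ (Submodule.subset_span (Set.mem_range_self i))
    rw [inner_sub_left, hz i] at h
    linarith
  · rw [← hspan]
    exact sub_affineProjection_mem_span _ _ _

end Projection

lemma span_comp_eq_of_linearIndependent {H ι κ : Type*} [NormedAddCommGroup H]
    [InnerProductSpace ℝ H] [Finite ι] [Fintype κ] {u : ι → H} {s : κ → ι}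
    (hs : LinearIndependent ℝ (u ∘ s)) (hcard : familyRank u = Fintype.card κ) :
    Submodule.span ℝ (Set.range (u ∘ s)) = Submodule.span ℝ (Set.range u) := by
  have : FiniteDimensional ℝ (Submodule.span ℝ (Set.range u)) :=
    FiniteDimensional.span_of_finite ℝ (Set.finite_range u)
  refine Submodule.eq_of_le_of_finrank_eq
    (Submodule.span_mono (Set.range_comp_subset_range s u)) ?_
  rw [finrank_span_eq_card hs, ← hcard, familyRank]

lemma _root_.LocallyLipschitz.pi {α ι : Type*} [PseudoEMetricSpace α] [Fintype ι]
    {E : ι → Type*} [∀ i, PseudoEMetricSpace (E i)] {φ : ∀ i, α → E i}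
    (h : ∀ i, LocallyLipschitz (φ i)) : LocallyLipschitz fun a i => φ i a := by
  intro a
  choose K t ht hK using fun i => h i a
  refine ⟨Finset.univ.sup K, ⋂ i, t i, Filter.iInter_mem.mpr ht, fun x hx y hy => ?_⟩
  refine edist_pi_le_iff.mpr fun i => (hK i (Set.mem_iInter.mp hx i)
    (Set.mem_iInter.mp hy i)).trans ?_
  gcongr
  exact Finset.le_sup (Finset.mem_univ i)

end MovingProjection

theorem mainTheorem10
    {H : Type*} [NormedAddCommGroup H] [InnerProductSpace ℝ H] [CompleteSpace H]
    {G : Type*} [NormedAddCommGroup G] [NormedSpace ℝ G] (D : Set G)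
    {q : ℕ} (f : Fin q → D → ℝ) (g : Fin q → D → H)
    (hf : ∀ i, LocallyLipschitz (f i)) (hg : ∀ i, LocallyLipschitz (g i))
    (pbar : D) (vbar xbar : H)
    (hv : vbar ∉ MovingProjection.constraintSet f g pbar)
    (hx : xbar = MovingProjection.projection (MovingProjection.constraintSet f g pbar) vbar)
    (hrank : ∃ U ∈ 𝓝 pbar, ∀ p ∈ U,
      MovingProjection.familyRank (fun i => g i p) =
        MovingProjection.familyRank (fun i => g i pbar))
    (hlim : xbar ∈
      MovingProjection.lowerKuratowskiLimit (MovingProjection.constraintSet f g) pbar) :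
    ∃ W ∈ 𝓝 vbar, ∃ U ∈ 𝓝 pbar,
      (∀ v ∈ W, ∀ p ∈ U, ∀ x : H,
        MovingProjection.IsProjection (MovingProjection.constraintSet f g p) v x ↔
          x = MovingProjection.projection (MovingProjection.constraintSet f g p) v) ∧
      ∃ L : ℝ≥0, LipschitzOnWith L
        (fun z : H × D =>
          MovingProjection.projection (MovingProjection.constraintSet f g z.2) z.1)
        (W ×ˢ U) := by
  obtain ⟨κ, s, hsinj, hspan, hli⟩ := exists_linearIndependent' ℝ (fun i => g i pbar)
  have : Finite κ := Finite.of_injective s hsinj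
  have := Fintype.ofFinite κ
  have hcard : MovingProjection.familyRank (fun i => g i pbar) = Fintype.card κ := by
    rw [← finrank_span_eq_card hli, hspan, MovingProjection.familyRank]
  have hgs : LocallyLipschitz fun (p : D) (j : κ) => g (s j) p :=
    LocallyLipschitz.pi fun j => hg (s j)
  have hfs : LocallyLipschitz fun (p : D) (j : κ) => f (s j) p :=
    LocallyLipschitz.pi fun j => hf (s j)
  have hunit : IsUnit (MovingProjection.gramOperator fun j => g (s j) pbar) :=
    MovingProjection.isUnit_gramOperator hli
  have hunit_near : ∀ᶠ p in 𝓝 pbar,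
      IsUnit (MovingProjection.gramOperator fun j => g (s j) p) :=
    ((MovingProjection.contDiff_gramOperator (H := H) (κ := κ)).continuous.comp hgs.continuous).continuousAt
      (Units.isOpen.mem_nhds hunit)
  have hli_near : ∀ᶠ p in 𝓝 pbar, LinearIndependent ℝ fun j => g (s j) p :=
    hgs.continuous.continuousAt.eventually hli.eventually
  obtain ⟨U₁, hU₁, hrank⟩ := hrank
  -- Only the nonemptiness of `C(p)` for `p` near `pbar` is needed, so the whole space serves as the
  -- neighbourhood of `xbar`.
  obtain ⟨U₂, hU₂, hne⟩ := hlim Set.univ univ_mem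
  have hproj : ∀ᶠ p in 𝓝 pbar, ∀ v x : H,
      MovingProjection.IsProjection (MovingProjection.constraintSet f g p) v x ↔
        x = MovingProjection.affineProjection (v, (fun j => f (s j) p), fun j => g (s j) p) := by
    filter_upwards [hunit_near, hli_near, hU₁, hU₂] with p hu hl h₁ h₂
    exact MovingProjection.isProjection_constraintSet_iff ((hne p h₂).mono Set.inter_subset_right)
      hu (MovingProjection.span_comp_eq_of_linearIndependent (u := fun i => g i p) hl
        ((hrank p h₁).trans hcard))
  have hdata : LocallyLipschitz fun z : H × D =>
      (z.1, (fun j : κ => f (s j) z.2), fun j : κ => g (s j) z.2) :=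
    LipschitzWith.prod_fst.locallyLipschitz.prodMk
      ((hfs.comp LipschitzWith.prod_snd.locallyLipschitz).prodMk
        (hgs.comp LipschitzWith.prod_snd.locallyLipschitz))
  obtain ⟨K₁, t₁, ht₁, hK₁⟩ := hdata (vbar, pbar)
  obtain ⟨K₂, t₂, ht₂, hK₂⟩ := (MovingProjection.contDiffAt_affineProjection
    (z := (vbar, (fun j => f (s j) pbar), fun j => g (s j) pbar)) hunit).exists_lipschitzOnWith
  -- The box `W × U` must also be mapped by the data into `t₂`, where the formula is Lipschitz.
  obtain ⟨W, hW, U, hU, hWU⟩ := mem_nhds_prod_iff.mp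
    (inter_mem ht₁ (hdata.continuous.continuousAt.preimage_mem_nhds ht₂))
  refine ⟨W, hW, U ∩ {p | ∀ v x : H,
      MovingProjection.IsProjection (MovingProjection.constraintSet f g p) v x ↔
        x = MovingProjection.affineProjection (v, (fun j => f (s j) p), fun j => g (s j) p)},
    inter_mem hU hproj, fun v _ p hp x => ?_, K₂ * K₁, ?_⟩
  · rw [MovingProjection.projection_eq_of_forall_isProjection_iff (hp.2 v)]
    exact hp.2 v x
  · have hcomp := (hK₂.comp (hK₁.mono Set.inter_subset_left) fun z hz => hz.2).mono hWU
    intro z hz w hw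
    change edist (MovingProjection.projection _ z.1) (MovingProjection.projection _ w.1) ≤ _
    rw [MovingProjection.projection_eq_of_forall_isProjection_iff (hz.2.2 z.1),
      MovingProjection.projection_eq_of_forall_isProjection_iff (hw.2.2 w.1)]
    exact hcomp ⟨hz.1, hz.2.1⟩ ⟨hw.1, hw.2.1⟩
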